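/- A two-rowed array consists of two finite, possibly empty, nonincreasing sequences of nonnegative integers, a top row $(a_1,\dots,a_{m_1})$ and a bottom row $(b_1,\dots,b_{m_2})$. Its row difference is $m_1-m_2$, and its weight is $$m_1+\sum_{i=1}^{m_1}a_i+\sum_{i=1}^{m_2}b_i .$$ For a nonnegative integer $m$, let $\varphi_{2,-1}(m)$ be the number of two-rowed arrays of weight $m$ and row difference $-1$ in which each nonnegative integer occurs at most twice in each row. Then, for every nonnegative integer $n$, $$\varphi_{2,-1}(5n+4)\equiv 0\pmod 5 .$$ -/

import Mathlib

/-- A row of an array: a list of nonnegative integers (zero is allowed) in nonincreasing order. -/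
def IsRow (l : List ℕ) : Prop := l.Pairwise (fun x y => y ≤ x)

/-- The two-rowed arrays (generalized Frobenius symbols) of weight `n` and row difference `α` in
which each nonnegative integer occurs at most `k` times in each row. An array is a pair
`(a, b)` consisting of its top row `a` and its bottom row `b`; the rows may have different lengths
and may be empty. The row difference is the length of `a` minus the length of `b`, and the weight
is the length of `a` plus the sum of all entries of both rows. -/
def frobeniusArrays (k : ℕ) (α : ℤ) (n : ℕ) : Set (List ℕ × List ℕ) :=
  {p | IsRow p.1 ∧ IsRow p.2 ∧
    (∀ j : ℕ, p.1.count j ≤ k) ∧ (∀ j : ℕ, p.2.count j ≤ k) ∧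
    (p.1.length : ℤ) - (p.2.length : ℤ) = α ∧
    p.1.length + p.1.sum + p.2.sum = n}

/-- The number `φ_{k,α}(n)` of arrays of weight `n` and row difference `α` in which each
nonnegative integer is repeated at most `k` times in each row. -/
noncomputable def frobeniusPhi (k : ℕ) (α : ℤ) (n : ℕ) : ℕ := (frobeniusArrays k α n).ncard

/-- There are only finitely many lists of bounded length with bounded entries. -/
theorem finite_boundedLists (N M : ℕ) :
    {l : List ℕ | l.length ≤ N ∧ ∀ x ∈ l, x < M}.Finite := by
  refine ((List.finite_length_le (Fin M) N).image (List.map Fin.val)).subset ?_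
  rintro l ⟨hl, hM⟩
  refine ⟨l.pmap Fin.mk hM, by simpa using hl, ?_⟩
  simp [List.map_pmap]

/-- The set of arrays counted by `frobeniusPhi` is finite, so its `ncard` is the true number of
its elements. -/
theorem frobeniusArrays_finite (k : ℕ) (α : ℤ) (n : ℕ) : (frobeniusArrays k α n).Finite := by
  refine ((finite_boundedLists n (n + 1)).prod
    (finite_boundedLists (n + α.natAbs) (n + 1))).subset ?_
  rintro ⟨a, b⟩ ⟨-, -, -, -, hd, hw⟩
  simp only at hd hw
  refine ⟨⟨by simp only; omega, fun x hx => ?_⟩, ⟨by simp only; omega, fun x hx => ?_⟩⟩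
  · have := List.le_sum_of_mem hx
    simp only at this
    omega
  · have := List.le_sum_of_mem hx
    simp only at this
    omega

/-!
Give an entry `j` of the top row the factor `z q ^ (j + 1)` and an entry `j` of the bottom row the
factor `z⁻¹ q ^ j`. The arrays with at most two repetitions are then generated by the product over
`j ≥ 0` of
`(1 + z q ^ (j + 1) + z ^ 2 q ^ (2 j + 2)) (1 + z⁻¹ q ^ j + z⁻² q ^ (2 j))`.
With a primitive cube root of unity `w`, the factorization `1 + x + x ^ 2 = (1 - w x) (1 - w ^ 2 x)`
splits it into two products to which the Jacobi triple product identity applies. Write `E` for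
`∏ (1 - q ^ (j + 1))` and `T k` for `k (k + 1) / 2`. The coefficient of `z⁻¹` is `E⁻²` times a sum of
terms `c q ^ (T k + T l)` with `k + l = -1`; there `T k = T l`, so that coefficient `Φ` satisfies
`E ^ 2 Φ = ∑ c_l q ^ (2 T l)` (`eulerProd_sq_mul_coeff`).

Jacobi's identity reads `2 E ^ 3 = ± ∑ ± (2 k + 1) q ^ (T k)`, the sum being over all integers `k`
(`two_mul_eulerProd_cube`). Hence `2 E ^ 5 Φ` is a combination of the `(2 k + 1) q ^ (T k + 2 T l)`.
If the exponent is `4` modulo `5`, then `(2 k + 1) ^ 2 + 2 (2 l + 1) ^ 2` is divisible by `5`, and so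
is `2 k + 1`, because `-2` is not a square modulo `5` (`triangular_add_mod_five_ne`). In
characteristic `5` the series `2 E ^ 5 Φ` therefore has no exponent that is `4` modulo `5`, and
neither has `Φ`, since `E ^ 5` is a series in `q ^ 5`.

No infinite products are needed. The triple product identity is proved in a finite form
(`eulerProd_mul_coeff_thetaProd`). For a coefficient below degree `M` one computes in `K[X] / (X ^ M)`,
where `K` is an algebraically closed field of characteristic `5`; there `q ^ M = 0`, so that long
finite products agree with the infinite ones.
-/

/-! ### Triangular numbers of integers -/

/-- The triangular number `k (k + 1) / 2` of an integer `k`, which is a natural number also for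
negative `k`. -/
def triangular (k : ℤ) : ℕ := (k * (k + 1) / 2).toNat

theorem two_mul_triangular (k : ℤ) : 2 * (triangular k : ℤ) = k * (k + 1) := by
  have h2 : (2 : ℤ) ∣ k * (k + 1) := (Int.even_mul_succ_self k).two_dvd
  have h0 : 0 ≤ k * (k + 1) := by
    rcases le_or_gt 0 k with h | h
    · positivity
    · nlinarith
  rw [triangular, Int.toNat_of_nonneg (by omega)]
  omega

theorem triangular_eq_of_add_eq_neg_one {k l : ℤ} (h : k + l = -1) :
    triangular k = triangular l := by
  obtain rfl : l = -1 - k := by omega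
  have h1 := two_mul_triangular k
  have h2 := two_mul_triangular (-1 - k)
  zify
  linarith [show (-1 - k) * (-1 - k + 1) = k * (k + 1) by ring]

theorem le_triangular_of_lt_natAbs {k : ℤ} {M : ℕ} (h : M < k.natAbs) :
    M ≤ triangular k := by
  have h1 := two_mul_triangular k
  rcases le_or_gt 0 k with h0 | h0
  · have : (M : ℤ) + 1 ≤ k := by omega
    zify
    nlinarith
  · have : (M : ℤ) + 1 ≤ -k := by omega
    have hM : (0 : ℤ) ≤ M := by positivity
    rcases Nat.eq_zero_or_pos M with rfl | hp
    · simp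
    have hp' : (1 : ℤ) ≤ M := by exact_mod_cast hp
    zify
    nlinarith

/-! ### The finite triple product identity -/

section FiniteTripleProduct

open Polynomial Finset

variable {S : Type*} [CommRing S]

/-- The finite Euler product `(1 - q) (1 - q ^ 2) ⋯ (1 - q ^ n)`. -/
def eulerProd (q : S) (n : ℕ) : S := ∏ j ∈ range n, (1 - q ^ (j + 1))

theorem eulerProd_succ (q : S) (n : ℕ) :
    eulerProd q (n + 1) = eulerProd q n * (1 - q ^ (n + 1)) := by
  simp [eulerProd, prod_range_succ]

/-- The finite theta product `∏_{j < a} (1 + q ^ (j + 1) z) · ∏_{j < b} (z + q ^ j)`, a polynomial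
in `z`. Up to the factor `z ^ b` it is the truncation of the product side
`∏ (1 + z q ^ (j + 1)) (1 + z⁻¹ q ^ j)` of the triple product identity. -/
noncomputable def thetaProd (q : S) (a b : ℕ) : S[X] :=
  (∏ j ∈ range a, (1 + C (q ^ (j + 1)) * X)) * ∏ j ∈ range b, (X + C (q ^ j))

theorem thetaProd_succ_left (q : S) (a b : ℕ) :
    thetaProd q (a + 1) b = thetaProd q a b + C (q ^ (a + 1)) * (thetaProd q a b * X) := by
  simp only [thetaProd, prod_range_succ]
  ring

theorem thetaProd_succ_right (q : S) (a b : ℕ) :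
    thetaProd q a (b + 1) = thetaProd q a b * X + C (q ^ b) * thetaProd q a b := by
  simp only [thetaProd, prod_range_succ]
  ring

theorem natDegree_thetaProd_le (q : S) (a b : ℕ) : (thetaProd q a b).natDegree ≤ a + b := by
  refine natDegree_mul_le.trans (add_le_add ?_ ?_)
  · refine (natDegree_prod_le _ _).trans ?_
    refine (sum_le_card_nsmul _ _ 1 fun j _ => ?_).trans (by simp)
    compute_degree
  · refine (natDegree_prod_le _ _).trans ?_
    refine (sum_le_card_nsmul _ _ 1 fun j _ => ?_).trans (by simp)
    compute_degree

theorem coeff_thetaProd_eq_zero (q : S) {a b i : ℕ} (h : a + b < i) :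
    (thetaProd q a b).coeff i = 0 :=
  coeff_eq_zero_of_natDegree_lt ((natDegree_thetaProd_le q a b).trans_lt h)

/-- The finite Jacobi triple product identity. The `i`-th coefficient of `thetaProd q a b` is
`q ^ triangular (i - b)` times a Gaussian binomial coefficient, stated without division; the two
inductions are the two Pascal rules for Gaussian binomials. -/
theorem eulerProd_mul_coeff_thetaProd (q : S) (a b : ℕ) : ∀ i j : ℕ, i + j = a + b →
    eulerProd q i * eulerProd q j * (thetaProd q a b).coeff i =
      q ^ triangular ((i : ℤ) - b) * eulerProd q (a + b) := by
  induction b with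
  | zero =>
    induction a with
    | zero =>
      intro i j h
      obtain ⟨rfl, rfl⟩ : i = 0 ∧ j = 0 := by omega
      simp [thetaProd, eulerProd, triangular]
    | succ a ih =>
      intro i j h
      rw [thetaProd_succ_left, coeff_add, coeff_C_mul,
        show a + 1 + 0 = (a + 0) + 1 by ring, eulerProd_succ]
      rcases i with _ | i
      · obtain rfl : j = a + 0 + 1 := by omega
        have := ih 0 (a + 0) (by omega)
        rw [coeff_mul_X_zero, eulerProd_succ]
        linear_combination (1 - q ^ (a + 0 + 1)) * this
      · have h1 := ih i j (by omega)
        have e : a + 1 + triangular ((i : ℤ) - (0 : ℕ)) =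
            triangular (((i + 1 : ℕ) : ℤ) - (0 : ℕ)) + j := by
          have t1 := two_mul_triangular ((i : ℤ) - (0 : ℕ))
          have t2 := two_mul_triangular (((i + 1 : ℕ) : ℤ) - (0 : ℕ))
          zify at h ⊢
          push_cast at t1 t2 h ⊢
          linarith
        have e' := congrArg (q ^ ·) e
        simp only [pow_add q (a + 1), pow_add q (triangular _)] at e'
        have hn : q ^ (a + 0 + 1) = q ^ (i + 1) * q ^ j := by
          rw [← pow_add]; congr 1; omega
        rw [coeff_mul_X]
        rcases j with _ | j
        · rw [coeff_thetaProd_eq_zero q (show a + 0 < i + 1 by omega), eulerProd_succ]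
          linear_combination (1 - q ^ (i + 1)) * q ^ (a + 1) * h1
            + (1 - q ^ (i + 1)) * eulerProd q (a + 0) * e'
            + q ^ triangular (((i + 1 : ℕ) : ℤ) - (0 : ℕ)) * eulerProd q (a + 0) * hn
        · have h2 := ih (i + 1) j (by omega)
          rw [eulerProd_succ q i] at h2 ⊢
          rw [eulerProd_succ q j] at h1 ⊢
          linear_combination (1 - q ^ (i + 1)) * q ^ (a + 1) * h1
            + (1 - q ^ (j + 1)) * h2 + (1 - q ^ (i + 1)) * eulerProd q (a + 0) * e'
            + q ^ triangular (((i + 1 : ℕ) : ℤ) - (0 : ℕ)) * eulerProd q (a + 0) * hn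
  | succ b ih =>
    intro i j h
    rw [thetaProd_succ_right, coeff_add, coeff_C_mul, ← add_assoc, eulerProd_succ]
    have e : ∀ i : ℕ, b + triangular ((i : ℤ) - b) =
        triangular ((i : ℤ) - (b + 1 : ℕ)) + i := by
      intro i
      have t1 := two_mul_triangular ((i : ℤ) - b)
      have t2 := two_mul_triangular ((i : ℤ) - (b + 1 : ℕ))
      zify
      push_cast at t1 t2 ⊢
      linarith
    rcases i with _ | i
    · obtain rfl : j = a + b + 1 := by omega
      have h1 := ih 0 (a + b) (by omega)
      have e' := congrArg (q ^ ·) (e 0)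
      simp only [pow_add] at e'
      rw [coeff_mul_X_zero, eulerProd_succ]
      linear_combination (1 - q ^ (a + b + 1)) * q ^ b * h1
        + (1 - q ^ (a + b + 1)) * eulerProd q (a + b) * e'
    · have h1 := ih i j (by omega)
      have e1 : (((i + 1 : ℕ) : ℤ) - (b + 1 : ℕ)) = (i : ℤ) - b := by push_cast; ring
      have e' := congrArg (q ^ ·) (e (i + 1))
      rw [e1] at e' ⊢
      simp only [pow_add] at e'
      have hn : q ^ (a + b + 1) = q ^ (i + 1) * q ^ j := by
        rw [← pow_add]; congr 1; omega
      rw [coeff_mul_X, hn]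
      rcases j with _ | j
      · rw [coeff_thetaProd_eq_zero q (show a + b < i + 1 by omega), eulerProd_succ]
        linear_combination (1 - q ^ (i + 1)) * h1
      · have h2 := ih (i + 1) j (by omega)
        rw [eulerProd_succ q i] at h2 ⊢
        rw [eulerProd_succ q j] at h1 ⊢
        linear_combination (1 - q ^ (i + 1)) * h1
          + q ^ b * (1 - q ^ (j + 1)) * h2 + (1 - q ^ (j + 1)) * eulerProd q (a + b) * e'

end FiniteTripleProduct

/-! ### The triple product and Jacobi's cube identity modulo a power of `q` -/

section NilpotentBase

open Polynomial Finset

variable {S : Type*} [CommRing S]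

theorem isUnit_eulerProd {q : S} (hq : IsNilpotent q) (n : ℕ) : IsUnit (eulerProd q n) := by
  induction n with
  | zero => simp [eulerProd]
  | succ n ih =>
    rw [eulerProd_succ]
    exact ih.mul (hq.pow_of_pos n.succ_ne_zero).isUnit_one_sub

theorem eulerProd_eq_of_le {q : S} {M n : ℕ} (hq : q ^ M = 0) (h : M ≤ n) :
    eulerProd q n = eulerProd q M := by
  induction n, h using Nat.le_induction with
  | base => rfl
  | succ n h ih => simp [eulerProd_succ, ih, pow_eq_zero_of_le (h.trans n.le_succ) hq]

/-- The Jacobi triple product identity modulo `q ^ M`: once `q ^ M = 0`, every coefficient of a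
long theta product is the power of `q` in the theta series divided by the Euler product. In the
middle range the Gaussian binomial coefficient has stabilised, and outside of it the power of `q`
vanishes. -/
theorem eulerProd_mul_coeff_thetaProd_of_pow_eq_zero {q : S} {M N i : ℕ} (hq : q ^ M = 0)
    (hN : 2 * M ≤ N) (hi : i ≤ N + N) :
    eulerProd q M * (thetaProd q N N).coeff i = q ^ triangular ((i : ℤ) - N) := by
  obtain ⟨j, hj⟩ := Nat.exists_eq_add_of_le hi
  have key := eulerProd_mul_coeff_thetaProd q N N i j hj.symm
  have hu := isUnit_eulerProd ⟨M, hq⟩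
  by_cases hij : M ≤ i ∧ M ≤ j
  · rw [eulerProd_eq_of_le hq hij.1, eulerProd_eq_of_le hq hij.2,
      eulerProd_eq_of_le hq (show M ≤ N + N by omega)] at key
    apply (hu M).mul_left_cancel
    linear_combination key
  · have h0 : q ^ triangular ((i : ℤ) - N) = 0 :=
      pow_eq_zero_of_le (le_triangular_of_lt_natAbs (by omega)) hq
    rw [h0, zero_mul] at key
    rw [h0, ((hu i).mul (hu j)).mul_right_eq_zero.mp key, mul_zero]

/-- The product side for two repetitions splits into two theta products at the primitive cube
roots of unity `w` and `w ^ 2`, since `1 + x + x ^ 2 = (1 - w x) (1 - w ^ 2 x)`. -/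
theorem prod_eq_thetaProd_comp_mul {w : S} (hw : w ^ 2 + w + 1 = 0) (q : S) (a b : ℕ) :
    (∏ j ∈ range a, (1 + C (q ^ (j + 1)) * X + C (q ^ (j + 1)) ^ 2 * X ^ 2)) *
      ∏ j ∈ range b, (X ^ 2 + C (q ^ j) * X + C (q ^ j) ^ 2) =
    (thetaProd q a b).comp (C (-w) * X) * (thetaProd q a b).comp (C (-w ^ 2) * X) := by
  have hC : (C w : S[X]) ^ 2 + C w + 1 = 0 := by
    rw [← C_pow, ← C_1, ← C_add, ← C_add, hw, C_0]
  simp only [thetaProd, mul_comp, Polynomial.prod_comp, add_comp, one_comp, C_comp, X_comp]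
  rw [mul_mul_mul_comm, ← prod_mul_distrib, ← prod_mul_distrib]
  congr 1 <;> refine prod_congr rfl fun j _ => ?_ <;> simp only [C_neg, C_pow]
  · linear_combination (C q ^ (j + 1) * X - (C w - 1) * (C q ^ (j + 1)) ^ 2 * X ^ 2) * hC
  · linear_combination (C q ^ j * X - (C w - 1) * X ^ 2) * hC

/-- The coefficient in the row difference `-1`, multiplied by the square of the Euler product, is
a combination of the powers `q ^ (k (k + 1))`: the two triangular numbers that occur in each
term are equal. -/
theorem eulerProd_sq_mul_coeff {w q : S} {M N : ℕ} (hq : q ^ M = 0) (hN : 2 * M ≤ N)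
    (hN' : 0 < N) :
    eulerProd q M ^ 2 *
      ((thetaProd q N N).comp (C (-w) * X) *
        (thetaProd q N N).comp (C (-w ^ 2) * X)).coeff (2 * N - 1) =
    ∑ p ∈ antidiagonal (2 * N - 1), (-w) ^ p.1 * (-w ^ 2) ^ p.2 *
      q ^ (2 * triangular ((p.1 : ℤ) - N)) := by
  rw [coeff_mul, mul_sum]
  refine sum_congr rfl fun p hp => ?_
  rw [HasAntidiagonal.mem_antidiagonal] at hp
  have h1 := eulerProd_mul_coeff_thetaProd_of_pow_eq_zero hq hN (show p.1 ≤ N + N by omega)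
  have h2 := eulerProd_mul_coeff_thetaProd_of_pow_eq_zero hq hN (show p.2 ≤ N + N by omega)
  rw [triangular_eq_of_add_eq_neg_one (show ((p.2 : ℤ) - N) + ((p.1 : ℤ) - N) = -1 by omega)] at h2
  rw [comp_C_mul_X_coeff, comp_C_mul_X_coeff, two_mul, pow_add]
  linear_combination (-w) ^ p.1 * (-w ^ 2) ^ p.2 *
    (eulerProd q M * (thetaProd q N N).coeff p.2 * h1 + q ^ triangular ((p.1 : ℤ) - N) * h2)

/-- Jacobi's identity for the cube of the Euler product, modulo `q ^ M`, obtained by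
differentiating the triple product at its zero `z = -1`. Twice the identity is summed over all
integers `k = i - N`, and a multiple of the (vanishing) value at `z = -1` makes the factor
`2 k + 1`. -/
theorem two_mul_eulerProd_cube {q : S} {M N : ℕ} (hq : q ^ M = 0) (hN : 2 * M ≤ N) (hN' : 0 < N) :
    2 * eulerProd q M ^ 3 =
      (-1) ^ N * ∑ i ∈ range (N + N + 1),
        ((2 * ((i : ℤ) - N) + 1 : ℤ) : S) * (-1) ^ i * q ^ triangular ((i : ℤ) - N) := by
  obtain ⟨n, rfl⟩ : ∃ n, N = n + 1 := ⟨N - 1, by omega⟩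
  set N := n + 1 with hNn
  set F := thetaProd q N N with hF
  -- the factor of the theta product that vanishes at `-1` is the one with `j = 0`
  have hfac : F = (X + 1) * ((∏ j ∈ range N, (1 + C (q ^ (j + 1)) * X)) *
      ∏ j ∈ range n, (X + C (q ^ (j + 1)))) := by
    rw [hF, thetaProd, hNn, prod_range_succ' (fun j => X + C (q ^ j))]
    simp only [pow_zero, C_1]
    ring
  have hroot : F.eval (-1) = 0 := by simp [hfac]
  have hder : F.derivative.eval (-1) = (-1) ^ n * eulerProd q M ^ 2 := by
    have h1 : ∏ j ∈ range N, (1 + q ^ (j + 1) * -1) = eulerProd q M := by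
      rw [← eulerProd_eq_of_le hq (show M ≤ N by omega), eulerProd]
      exact prod_congr rfl fun j _ => by ring
    have h2 : ∏ j ∈ range n, (-1 + q ^ (j + 1)) = (-1) ^ n * eulerProd q M := by
      rw [← eulerProd_eq_of_le hq (show M ≤ n by omega), eulerProd]
      conv_rhs => rw [← card_range n, ← prod_const, card_range, ← prod_mul_distrib]
      exact prod_congr rfl fun j _ => by ring
    rw [hfac, derivative_mul, eval_add, eval_mul, eval_mul]
    simp only [derivative_add, derivative_X, derivative_one, eval_add, eval_X, eval_one, eval_mul,
      eval_prod, eval_C, add_zero, one_mul, neg_add_cancel, zero_mul, h1, h2]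
    ring
  have hdeg : F.natDegree < N + N + 1 := Nat.lt_succ_of_le (natDegree_thetaProd_le q N N)
  have hdeg' : (X * F.derivative).natDegree < N + N + 1 := by
    have := natDegree_derivative_le F
    have := natDegree_mul_le (p := (X : S[X])) (q := F.derivative)
    have := natDegree_X_le (R := S)
    omega
  rw [eval_eq_sum_range' hdeg] at hroot
  have hder' : (X * F.derivative).eval (-1) = (-1) ^ N * eulerProd q M ^ 2 := by
    rw [eval_mul, eval_X, hder, hNn]; ring
  rw [eval_eq_sum_range' hdeg'] at hder'
  have hcoeff : ∀ i, (X * F.derivative).coeff i = i * F.coeff i := by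
    rintro (_ | i)
    · simp
    · rw [coeff_X_mul, coeff_derivative]; push_cast; ring
  simp only [hcoeff] at hder'
  have hsum : ∑ i ∈ range (N + N + 1),
        ((2 * ((i : ℤ) - N) + 1 : ℤ) : S) * (-1) ^ i * q ^ triangular ((i : ℤ) - N) =
      2 * eulerProd q M * ((-1) ^ N * eulerProd q M ^ 2) := by
    rw [← hder', ← add_zero (_ * _), ← mul_zero ((1 - 2 * (N : S)) * eulerProd q M), ← hroot,
      mul_sum, mul_sum, ← sum_add_distrib]
    refine sum_congr rfl fun i hi => ?_
    rw [mem_range] at hi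
    rw [← eulerProd_mul_coeff_thetaProd_of_pow_eq_zero hq hN (show i ≤ N + N by omega)]
    push_cast
    ring
  rw [hsum]
  have hs : ((-1 : S) ^ N) * (-1) ^ N = 1 := by rw [← mul_pow]; simp
  linear_combination -2 * eulerProd q M ^ 3 * hs

end NilpotentBase

/-! ### The generating function of the arrays -/

section Counting

open Polynomial Finset

variable {N : ℕ}

/-- The row in which each `j < N` occurs `c j` times and nothing else occurs. -/
def rowOfCounts (c : Fin N → Fin 3) : List ℕ :=
  (∑ j : Fin N, Multiset.replicate (c j : ℕ) (j : ℕ)).sort (· ≥ ·)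

theorem isRow_rowOfCounts (c : Fin N → Fin 3) : IsRow (rowOfCounts c) :=
  Multiset.pairwise_sort _ _

theorem length_rowOfCounts (c : Fin N → Fin 3) :
    (rowOfCounts c).length = ∑ j, (c j : ℕ) := by
  simp [rowOfCounts]

theorem sum_rowOfCounts (c : Fin N → Fin 3) :
    (rowOfCounts c).sum = ∑ j : Fin N, (j : ℕ) * c j := by
  rw [← Multiset.sum_coe, rowOfCounts, Multiset.sort_eq]
  simp [Multiset.sum_sum, mul_comm]

theorem count_rowOfCounts (c : Fin N → Fin 3) (i : ℕ) :
    (rowOfCounts c).count i = if h : i < N then (c ⟨i, h⟩ : ℕ) else 0 := by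
  rw [← Multiset.coe_count, rowOfCounts, Multiset.sort_eq, Multiset.count_sum']
  simp only [Multiset.count_replicate]
  split_ifs with h
  · rw [sum_eq_single ⟨i, h⟩]
    · simp
    · intro j _ hj
      rw [if_neg]
      rintro rfl
      exact hj rfl
    · simp
  · refine sum_eq_zero fun j _ => if_neg ?_
    have := j.2
    omega

theorem rowOfCounts_injective : Function.Injective (rowOfCounts (N := N)) := by
  intro c d h
  ext j
  have := congrArg (List.count (j : ℕ)) h
  simpa [count_rowOfCounts] using this

theorem exists_rowOfCounts_eq {l : List ℕ} (hl : IsRow l) (hc : ∀ j, l.count j ≤ 2)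
    (hN : ∀ x ∈ l, x < N) : ∃ c : Fin N → Fin 3, rowOfCounts c = l := by
  refine ⟨fun j => ⟨l.count (j : ℕ), Nat.lt_succ_of_le (hc j)⟩, ?_⟩
  refine List.Perm.eq_of_pairwise (fun a b _ _ h1 h2 => le_antisymm h2 h1)
    (isRow_rowOfCounts _) hl (List.perm_iff_count.2 fun i => ?_)
  rw [count_rowOfCounts]
  split_ifs with h
  · rfl
  · exact (List.count_eq_zero.2 fun hi => h (hN i hi)).symm

/-- The pairs of multiplicity functions of the arrays of row difference `-1` with entries below
`N`. -/
def countPairs (N : ℕ) : Finset ((Fin N → Fin 3) × (Fin N → Fin 3)) :=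
  {p | ∑ j, (p.2 j : ℕ) = ∑ j, (p.1 j : ℕ) + 1}

/-- The weight of the array with the given multiplicity functions. -/
def countWeight (p : (Fin N → Fin 3) × (Fin N → Fin 3)) : ℕ :=
  ∑ j : Fin N, ((j : ℕ) + 1) * (p.1 j : ℕ) + ∑ j : Fin N, (j : ℕ) * p.2 j

/-- An array of weight `n < N` has all its entries below `N`, so it is determined by its
multiplicity functions on `Fin N`. -/
theorem frobeniusPhi_eq_card {n : ℕ} (hn : n < N) :
    frobeniusPhi 2 (-1) n = #{p ∈ countPairs N | countWeight p = n} := by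
  rw [frobeniusPhi, ← Set.ncard_coe_finset,
    ← Set.ncard_image_of_injective _ (rowOfCounts_injective.prodMap rowOfCounts_injective)]
  congr 1
  ext ⟨a, b⟩
  have hw : ∀ c : Fin N → Fin 3, ∑ j : Fin N, ((j : ℕ) + 1) * (c j : ℕ) =
      (rowOfCounts c).length + (rowOfCounts c).sum := by
    intro c
    rw [length_rowOfCounts, sum_rowOfCounts, ← sum_add_distrib]
    exact sum_congr rfl fun j _ => by ring
  simp only [Set.mem_image, coe_filter, Set.mem_ofPred_eq, Prod.exists, Prod.map_apply,
    Prod.mk.injEq, frobeniusArrays, countPairs, countWeight, mem_filter, mem_univ, true_and, hw,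
    ← sum_rowOfCounts, ← length_rowOfCounts]
  constructor
  · rintro ⟨ha, hb, hca, hcb, hd, hs⟩
    obtain ⟨c, rfl⟩ := exists_rowOfCounts_eq (N := N) ha hca fun x hx => by
      have := List.le_sum_of_mem hx
      omega
    obtain ⟨d, rfl⟩ := exists_rowOfCounts_eq (N := N) hb hcb fun x hx => by
      have := List.le_sum_of_mem hx
      omega
    exact ⟨c, d, ⟨by omega, hs⟩, rfl, rfl⟩
  · rintro ⟨c, d, ⟨hd, hs⟩, rfl, rfl⟩
    have hc : ∀ (c : Fin N → Fin 3) (j : ℕ), (rowOfCounts c).count j ≤ 2 := by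
      intro c j
      rw [count_rowOfCounts]
      split_ifs <;> omega
    exact ⟨isRow_rowOfCounts c, isRow_rowOfCounts d, hc c, hc d, by omega, hs⟩

/-- The product side for two repetitions generates the arrays. It carries an additional factor
`X ^ (2 * N)`, so row difference `-1` is read off in degree `2 * N - 1`. -/
theorem coeff_prod_eq_sum_countPairs {S : Type*} [CommRing S] (q : S) (hN : 0 < N) :
    ((∏ j ∈ range N, (1 + C (q ^ (j + 1)) * X + C (q ^ (j + 1)) ^ 2 * X ^ 2)) *
      ∏ j ∈ range N, (X ^ 2 + C (q ^ j) * X + C (q ^ j) ^ 2)).coeff (2 * N - 1) =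
    ∑ p ∈ countPairs N, q ^ countWeight p := by
  have h1 : ∏ j ∈ range N, (1 + C (q ^ (j + 1)) * X + C (q ^ (j + 1)) ^ 2 * X ^ 2) =
      ∑ c : Fin N → Fin 3, C (q ^ ∑ j : Fin N, ((j : ℕ) + 1) * (c j : ℕ)) *
        X ^ ∑ j, (c j : ℕ) := by
    have : ∀ j : ℕ, 1 + C (q ^ (j + 1)) * X + C (q ^ (j + 1)) ^ 2 * X ^ 2 =
        ∑ x : Fin 3, C (q ^ ((j + 1) * (x : ℕ))) * X ^ (x : ℕ) := by
      intro j
      simp [Fin.sum_univ_three, pow_mul]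
    rw [prod_range]
    simp only [this]
    rw [prod_univ_sum, Fintype.piFinset_univ]
    refine sum_congr rfl fun c _ => ?_
    rw [prod_mul_distrib, prod_pow_eq_pow_sum, ← prod_pow_eq_pow_sum univ _ q, map_prod]
  have h2 : ∏ j ∈ range N, (X ^ 2 + C (q ^ j) * X + C (q ^ j) ^ 2) =
      ∑ d : Fin N → Fin 3, C (q ^ ∑ j : Fin N, (j : ℕ) * (d j : ℕ)) *
        X ^ ∑ j, (2 - (d j : ℕ)) := by
    have : ∀ j : ℕ, X ^ 2 + C (q ^ j) * X + C (q ^ j) ^ 2 =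
        ∑ x : Fin 3, C (q ^ (j * (x : ℕ))) * X ^ (2 - (x : ℕ)) := by
      intro j
      simp [Fin.sum_univ_three, pow_mul]
    rw [prod_range]
    simp only [this]
    rw [prod_univ_sum, Fintype.piFinset_univ]
    refine sum_congr rfl fun c _ => ?_
    rw [prod_mul_distrib, prod_pow_eq_pow_sum, ← prod_pow_eq_pow_sum univ _ q, map_prod]
  rw [h1, h2, sum_mul_sum, ← sum_product', univ_product_univ, finsetSum_coeff, countPairs,
    sum_filter]
  refine sum_congr rfl fun p _ => ?_
  have hd : ∑ j, (2 - (p.2 j : ℕ)) + ∑ j, (p.2 j : ℕ) = 2 * N := by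
    rw [← sum_add_distrib, sum_congr rfl fun j _ =>
      show 2 - (p.2 j : ℕ) + (p.2 j : ℕ) = 2 by omega]
    simp [mul_comm]
  rw [mul_mul_mul_comm, ← C_mul, ← pow_add, ← pow_add, coeff_C_mul, coeff_X_pow, mul_ite, mul_one,
    mul_zero, ← countWeight]
  exact if_congr (by omega) rfl rfl

end Counting

/-! ### Exponents modulo five -/

section ModFive

open Polynomial Finset

variable (K : Type*) [Field K]

/-- The polynomials without terms whose exponent is `4` modulo `5`. -/
def noFourModFive : Submodule K K[X] where
  carrier := {f | ∀ n, n % 5 = 4 → f.coeff n = 0}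
  add_mem' hf hg n hn := by rw [coeff_add, hf n hn, hg n hn, add_zero]
  zero_mem' n _ := coeff_zero n
  smul_mem' c f hf n hn := by rw [coeff_smul, hf n hn, smul_zero]

variable {K}

theorem X_pow_mem_noFourModFive {m : ℕ} (hm : m % 5 ≠ 4) : (X ^ m : K[X]) ∈ noFourModFive K := by
  intro n hn
  rw [coeff_X_pow, if_neg]
  rintro rfl
  exact hm hn

/-- In characteristic `5` a fifth power has only exponents divisible by `5`. -/
theorem pow_five_mul_mem_noFourModFive [CharP K 5] (g : K[X]) {f : K[X]}
    (hf : f ∈ noFourModFive K) : g ^ 5 * f ∈ noFourModFive K := by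
  intro n hn
  have : Fact (Nat.Prime 5) := ⟨by norm_num⟩
  have : ExpChar K 5 := inferInstance
  rw [coeff_mul]
  refine sum_eq_zero fun p hp => ?_
  rw [HasAntidiagonal.mem_antidiagonal] at hp
  by_cases h5 : 5 ∣ p.1
  · rw [hf p.2 (by omega), mul_zero]
  · rw [← map_frobenius_expand, coeff_map, coeff_expand (by norm_num), if_neg h5, map_zero, zero_mul]

/-- Eight times `T k + 2 T l` plus `3`, where `T` is the triangular number, is
`(2 k + 1) ^ 2 + 2 (2 l + 1) ^ 2`. As `-2` is not a square modulo `5`, this form is divisible by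
`5` only if `2 k + 1` is. -/
theorem triangular_add_mod_five_ne {k l : ℤ} (hk : ¬ (5 : ℤ) ∣ 2 * k + 1) :
    (triangular k + 2 * triangular l) % 5 ≠ 4 := by
  intro h
  have h1 := two_mul_triangular k
  have h2 := two_mul_triangular l
  have h5 : (5 : ℤ) ∣ (2 * k + 1) ^ 2 + 2 * (2 * l + 1) ^ 2 := by
    have : (2 * k + 1) ^ 2 + 2 * (2 * l + 1) ^ 2 =
        8 * ((triangular k : ℤ) + 2 * triangular l) + 3 := by linarith
    omega
  -- `-2` is not a square modulo `5`
  have hform : ∀ x y : ZMod 5, x ^ 2 + 2 * y ^ 2 = 0 → x = 0 := by decide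
  have hx := hform ((2 * k + 1 : ℤ) : ZMod 5) ((2 * l + 1 : ℤ) : ZMod 5) (by
    exact_mod_cast (ZMod.intCast_zmod_eq_zero_iff_dvd _ 5).2 h5)
  exact hk ((ZMod.intCast_zmod_eq_zero_iff_dvd _ 5).1 hx)

/-- In a quotient of `K[X]` in which the variable is nilpotent, the generating function of the arrays
is represented without exponents that are `4` modulo `5`. With `E` the Euler product, twice
`E ^ 5` times it is the product of the two theta series for `2 E ^ 3` and for `E ^ 2` times it; its
terms `(2 k + 1) q ^ (T k + 2 T l)` vanish or have an admissible exponent, and dividing by the fifth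
power `E ^ 5` preserves this. -/
theorem map_sum_countPairs_mem [CharP K 5] {w : K} (hw : w ^ 2 + w + 1 = 0) {M N : ℕ}
    (hN : 2 * M ≤ N) (hN' : 0 < N) {S : Type*} [CommRing S] [Algebra K S] {π : K[X] →ₐ[K] S}
    (hsurj : Function.Surjective π) (hπ : π X ^ M = 0) :
    π (∑ p ∈ countPairs N, (X : K[X]) ^ countWeight p) ∈
      (noFourModFive K).map π.toLinearMap := by
  set q := π X with hqdef
  have hq : q ^ M = 0 := hπ
  set W := (noFourModFive K).map π.toLinearMap
  set E := eulerProd q M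
  have hpow : ∀ m, m % 5 ≠ 4 → q ^ m ∈ W := fun m hm =>
    ⟨X ^ m, X_pow_mem_noFourModFive hm, by simp [hqdef]⟩
  have h5 : ∀ g x, x ∈ W → g ^ 5 * x ∈ W := by
    rintro g _ ⟨f, hf, rfl⟩
    obtain ⟨g, rfl⟩ := hsurj g
    exact ⟨g ^ 5 * f, pow_five_mul_mem_noFourModFive g hf, by simp⟩
  rw [map_sum]
  simp only [map_pow, ← hqdef]
  set Φ := ∑ p ∈ countPairs N, q ^ countWeight p
  set u := algebraMap K S w with hu
  have hu0 : u ^ 2 + u + 1 = 0 := by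
    rw [hu, ← map_pow, ← map_add, ← map_one (algebraMap K S), ← map_add, hw, map_zero]
  have hA : E ^ 2 * Φ = ∑ p ∈ antidiagonal (2 * N - 1), (-u) ^ p.1 * (-u ^ 2) ^ p.2 *
      q ^ (2 * triangular ((p.1 : ℤ) - N)) := by
    rw [← eulerProd_sq_mul_coeff hq hN hN', ← prod_eq_thetaProd_comp_mul hu0,
      coeff_prod_eq_sum_countPairs q hN']
  have hB := two_mul_eulerProd_cube hq hN hN'
  have hmem : E ^ 5 * Φ ∈ W := by
    have h2 : (2 : K) ≠ 0 := by
      intro h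
      have := (CharP.cast_eq_zero_iff K 5 2).1 (by exact_mod_cast h)
      omega
    have key : (2 : K) • (E ^ 5 * Φ) ∈ W := by
      have e : (2 : K) • (E ^ 5 * Φ) = (2 * E ^ 3) * (E ^ 2 * Φ) := by
        rw [Algebra.smul_def, map_ofNat]; ring
      rw [e, hA, hB, mul_assoc, sum_mul_sum, mul_sum]
      refine sum_mem fun i _ => ?_
      rw [mul_sum]
      refine sum_mem fun p _ => ?_
      set k : ℤ := (i : ℤ) - N
      set l : ℤ := (p.1 : ℤ) - N
      by_cases hk : (5 : ℤ) ∣ 2 * k + 1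
      · have h0 : ((2 * k + 1 : ℤ) : S) = 0 := by
          rw [← map_intCast (algebraMap K S), (CharP.intCast_eq_zero_iff K 5 _).2 hk, map_zero]
        rw [h0]
        simp
      · have hm := W.smul_mem ((-1) ^ N * (((2 * k + 1 : ℤ) : K) * (-1) ^ i) *
          ((-w) ^ p.1 * (-w ^ 2) ^ p.2)) (hpow _ (triangular_add_mod_five_ne (l := l) hk))
        convert hm using 1
        rw [Algebra.smul_def, pow_add]
        simp only [map_mul, map_pow, map_neg, map_one, map_intCast, ← hu]
        ring
    simpa [smul_smul, h2] using W.smul_mem (2 : K)⁻¹ key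
  obtain ⟨e, he⟩ := (isUnit_eulerProd ⟨M, hq⟩ M).exists_left_inv
  have : Φ = e ^ 5 * (E ^ 5 * Φ) := by rw [← mul_assoc, ← mul_pow, he, one_pow, one_mul]
  rw [this]
  exact h5 e _ hmem

/-- Modulo `X ^ M`, the generating polynomial of the arrays has no exponent that is `4`
modulo `5`. -/
theorem exists_mem_noFourModFive [CharP K 5] {w : K} (hw : w ^ 2 + w + 1 = 0) {M N : ℕ}
    (hN : 2 * M ≤ N) (hN' : 0 < N) :
    ∃ v ∈ noFourModFive K,
      X ^ M ∣ ∑ p ∈ countPairs N, (X : K[X]) ^ countWeight p - v := by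
  obtain ⟨v, hv, hv'⟩ := map_sum_countPairs_mem hw hN hN'
    (Ideal.Quotient.mkₐ_surjective K (Ideal.span {(X : K[X]) ^ M})) (by
      rw [← map_pow, Ideal.Quotient.mkₐ_eq_mk, Ideal.Quotient.eq_zero_iff_mem]
      exact Ideal.mem_span_singleton_self _)
  refine ⟨v, hv, ?_⟩
  rw [← Ideal.mem_span_singleton, ← Ideal.Quotient.eq, ← Ideal.Quotient.mkₐ_eq_mk K]
  exact hv'.symm

end ModFive

/-- The number of arrays of weight `5 n + 4` and row difference `-1` in which each nonnegative
integer is repeated at most twice in each row is divisible by `5`. -/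
theorem mainTheorem1 : ∀ n : ℕ, frobeniusPhi 2 (-1) (5 * n + 4) ≡ 0 [MOD 5] := by
  intro n
  have : Fact (Nat.Prime 5) := ⟨by norm_num⟩
  let K := AlgebraicClosure (ZMod 5)
  have : CharP K 5 := charP_of_injective_algebraMap (algebraMap (ZMod 5) K).injective 5
  obtain ⟨w, hw⟩ := IsAlgClosed.exists_root
    (Polynomial.X ^ 2 + Polynomial.X + 1 : Polynomial K) (by
      rw [show (Polynomial.X ^ 2 + Polynomial.X + 1 : Polynomial K).degree = 2 by compute_degree!]
      norm_num)
  obtain ⟨v, hv, hdvd⟩ := exists_mem_noFourModFive (K := K) (w := w)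
    (by simpa using hw) (M := 5 * n + 5) (N := 2 * (5 * n + 5)) le_rfl (by omega)
  have h := Polynomial.X_pow_dvd_iff.1 hdvd (5 * n + 4) (by omega)
  rw [Polynomial.coeff_sub, hv (5 * n + 4) (by omega), sub_zero, Polynomial.finsetSum_coeff] at h
  simp only [Polynomial.coeff_X_pow, Finset.sum_boole, eq_comm (a := 5 * n + 4)] at h
  rw [← frobeniusPhi_eq_card (by omega), CharP.cast_eq_zero_iff K 5] at h
  exact (Nat.modEq_zero_iff_dvd).2 h
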